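/- For $p\in(0,1)$ let $\mu_p$ be the product measure on $\{0,1\}^n$ with $\mu_p(x)=p^{\sum_i x_i}(1-p)^{\sum_i(1-x_i)}$. Say that $g,h\colon\{0,1\}^n\to\mathbb{R}$ are $\delta$-close with respect to $\mu_p$ if $\mathbb{E}_{x\sim\mu_p}[(g(x)-h(x))^2]\le\delta$. An affine function is a function of the form $x\mapsto c_0+\sum_{i=1}^n c_i x_i$ with real $c_0,\dots,c_n$. By convention $\max_{i\in\emptyset}x_i=0$ and $\min_{i\in\emptyset}x_i=1$. There is an absolute constant $C>0$ such that the following holds for all integers $n\ge 0$, all $p\in(0,1)$ and all real $\epsilon$. Suppose $f\colon\{0,1\}^n\to\{0,1\}$ is $\epsilon$-close to some affine function with respect to $\mu_p$ (so that $\epsilon\ge0$). Then there is a set $S\subseteq\{1,\dots,n\}$ with \[ |S|\le\max\Bigl(1,\ C\,\frac{\sqrt{\epsilon}}{\min(p,1-p)}\Bigr) \] such that: if $p\le 1/2$, then $f$ or $1-f$ is $C\epsilon$-close to $\max_{i\in S}x_i$ with respect to $\mu_p$; if $p>1/2$, then $f$ or $1-f$ is $C\epsilon$-close to $\min_{i\in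 S}x_i$ with respect to $\mu_p$. -/

import Mathlib

namespace BiasedCube

/-- The Boolean cube `{0,1}ⁿ`, with `false` standing for `0` and `true` for `1`. -/
abbrev Cube (n : ℕ) : Type := Fin n → Bool

/-- The real value `0` or `1` of a bit. -/
def bitVal (b : Bool) : ℝ := if b = true then 1 else 0

/-- A Boolean function on the cube, regarded as a real-valued function. -/
def boolFun {n : ℕ} (f : Cube n → Bool) : Cube n → ℝ := fun x => bitVal (f x)

/-- The value of the measure `μ_p` on the atom `x`:
`p` to the number of ones of `x`, times `1 - p` to the number of zeros of `x`. -/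
noncomputable def muP {n : ℕ} (p : ℝ) (x : Cube n) : ℝ :=
  p ^ (∑ i, (x i).toNat) * (1 - p) ^ (∑ i, (1 - (x i).toNat))

/-- The squared `L²` norm `E[g²]` with respect to `μ_p`. -/
noncomputable def normSq {n : ℕ} (p : ℝ) (g : Cube n → ℝ) : ℝ :=
  ∑ x, muP p x * g x ^ 2

/-- `g` and `h` are `ε`-close with respect to `μ_p`. -/
def IsClose {n : ℕ} (p ε : ℝ) (g h : Cube n → ℝ) : Prop :=
  normSq p (g - h) ≤ ε

/-- Affine functions `c₀ + ∑ cᵢ xᵢ` on the cube. -/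
def IsAffine {n : ℕ} (g : Cube n → ℝ) : Prop :=
  ∃ (c₀ : ℝ) (c : Fin n → ℝ), ∀ x, g x = c₀ + ∑ i, c i * bitVal (x i)

/-- The function `max_{i ∈ S} xᵢ`; it is `0` when `S` is empty. -/
noncomputable def maxVars {n : ℕ} (S : Finset (Fin n)) : Cube n → ℝ := boolFun fun x => S.sup x

/-- The function `min_{i ∈ S} xᵢ`; it is `1` when `S` is empty. -/
noncomputable def minVars {n : ℕ} (S : Finset (Fin n)) : Cube n → ℝ := boolFun fun x => S.inf x

end BiasedCube

namespace BiasedCube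

/-! ### Expectation with respect to `μ_p` -/

/-! Let `f` be close to `l = c₀ + ∑ cᵢxᵢ`. Resample the coordinates in a set `I`: `f` changes by -1,
0 or 1, so the change of `l`, a sum of independent symmetric terms equal to `±cᵢ` with probability
`p(1-p)` each and to 0 otherwise, has expected squared distance at most `4ε` to `{-1,0,1}`. This
holds for every `I` (`symE_sqDist_le`) and controls all coefficients when `ε` is small; large `ε` is
trivial. Put `q = 2p(1-p)`.

Coefficients with `|cᵢ| ≤ 1/2` have `q∑cᵢ² = O(ε)`: a fourth moment comparison leaves only a tiny or
a large second moment, and adding coordinates one at a time never jumps between them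
(`symE_sq_le_of_small`). Among the others, on a set of size at most `1/q`, the event that a single
coordinate changes gives `q∑ sqDist(cᵢ) = O(ε)`, and the event that two coefficients near `±1`
change gives `|G|(|G|-1)q² = O(ε)` for the set `G` of such coefficients. The size condition holds
automatically.

Rounding coefficients in `G` to signs and the rest to 0 therefore leaves a form of variance `O(ε)`,
nearly constant (`exists_close_signed_sum`). For `p ≤ 1/2` and `|G| ≥ 2`, two ones in `G` occur with
probability `O(ε)`; otherwise the signed sum has at most one term, and `f` or `1-f` agrees with a
maximum up to the approximation error (`sub_maxVars_sq_le`). If `|G| ≤ 1`, rounding suffices.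
Complementing the cube handles `p > 1/2`. -/

/-- The weight of a single bit. -/
def bitWeight (p : ℝ) (b : Bool) : ℝ := if b = true then p else 1 - p

/-- The expectation with respect to `μ_p`. -/
noncomputable def expect {n : ℕ} (p : ℝ) (F : Cube n → ℝ) : ℝ := ∑ x, muP p x * F x

variable {n : ℕ} {p : ℝ}

theorem muP_eq_prod (x : Cube n) : muP p x = ∏ i, bitWeight p (x i) := by
  unfold muP
  rw [← Finset.prod_pow_eq_pow_sum, ← Finset.prod_pow_eq_pow_sum, ← Finset.prod_mul_distrib]
  refine Finset.prod_congr rfl fun i _ => ?_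
  cases x i <;> simp [bitWeight]

theorem muP_nonneg (h0 : 0 < p) (h1 : p < 1) (x : Cube n) : 0 ≤ muP p x := by
  unfold muP
  have : 0 < 1 - p := by linarith
  positivity

theorem normSq_eq_expect (g : Cube n → ℝ) : normSq p g = expect p fun x => g x ^ 2 := rfl

theorem expect_add (F G : Cube n → ℝ) :
    expect p (fun x => F x + G x) = expect p F + expect p G := by
  simp [expect, mul_add, Finset.sum_add_distrib]

theorem expect_const_mul (a : ℝ) (F : Cube n → ℝ) :
    expect p (fun x => a * F x) = a * expect p F := by
  simp only [expect, Finset.mul_sum]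
  exact Finset.sum_congr rfl fun x _ => by ring

theorem expect_sum {ι : Type*} (s : Finset ι) (F : ι → Cube n → ℝ) :
    expect p (fun x => ∑ i ∈ s, F i x) = ∑ i ∈ s, expect p (F i) := by
  simp only [expect, Finset.mul_sum]
  exact Finset.sum_comm

theorem expect_mono (h0 : 0 < p) (h1 : p < 1) {F G : Cube n → ℝ} (h : ∀ x, F x ≤ G x) :
    expect p F ≤ expect p G :=
  Finset.sum_le_sum fun x _ => mul_le_mul_of_nonneg_left (h x) (muP_nonneg h0 h1 x)

theorem expect_coord (i : Fin n) (g : Bool → ℝ) :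
    expect p (fun x => g (x i)) = p * g true + (1 - p) * g false := by
  classical
  have key := Finset.prod_univ_sum (fun _ : Fin n => (Finset.univ : Finset Bool))
    (fun j b => bitWeight p b * (if j = i then g b else 1))
  have hl : ∏ j : Fin n, ∑ b : Bool, bitWeight p b * (if j = i then g b else 1) =
      p * g true + (1 - p) * g false := by
    rw [Finset.prod_eq_single i]
    · simp [bitWeight]
    · intro j _ hj
      simp [bitWeight, hj]
    · simp
  rw [← hl, key, Fintype.piFinset_univ]
  refine Finset.sum_congr rfl fun x _ => ?_
  rw [Finset.prod_mul_distrib, muP_eq_prod]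
  congr 1
  simp

theorem sum_muP : ∑ x : Cube n, muP p x = 1 := by
  have key := Finset.prod_univ_sum (fun _ : Fin n => (Finset.univ : Finset Bool))
    (fun _ b => bitWeight p b)
  simp only [Fintype.piFinset_univ] at key
  simp only [muP_eq_prod, ← key]
  simp [bitWeight]

theorem expect_const (a : ℝ) : expect p (fun _ : Cube n => a) = a := by
  simp [expect, ← Finset.sum_mul, sum_muP]

/-- Some point of the cube does at least as well as the average. -/
theorem exists_le_expect (h0 : 0 < p) (h1 : p < 1) (F : Cube n → ℝ) :
    ∃ x, F x ≤ expect p F := by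
  by_contra! h
  obtain ⟨m, hm⟩ := Finite.exists_min F
  have h2 : expect p (fun _ : Cube n => F m) ≤ expect p F := expect_mono h0 h1 hm
  rw [expect_const] at h2
  exact absurd h2 (not_le.2 (h m))

/-! ### Pairs of independent points -/

/-- The expectation over two independent points. -/
noncomputable def expectPair {n : ℕ} (p : ℝ) (F : Cube n → Cube n → ℝ) : ℝ :=
  expect p fun x => expect p fun y => F x y

/-- Take the coordinates in `I` from `y` and the others from `x`. -/
def mix (I : Finset (Fin n)) (x y : Cube n) : Cube n := fun i => if i ∈ I then y i else x i

theorem mix_mix (I : Finset (Fin n)) (x y : Cube n) : mix I (mix I x y) (mix I y x) = x := by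
  funext i
  by_cases h : i ∈ I <;> simp [mix, h]

theorem muP_mix_mul (I : Finset (Fin n)) (x y : Cube n) :
    muP p (mix I x y) * muP p (mix I y x) = muP p x * muP p y := by
  simp only [muP_eq_prod, ← Finset.prod_mul_distrib]
  refine Finset.prod_congr rfl fun i _ => ?_
  by_cases h : i ∈ I <;> simp [mix, h, mul_comm]

theorem expectPair_eq_sum (F : Cube n → Cube n → ℝ) :
    expectPair p F = ∑ z : Cube n × Cube n, muP p z.1 * muP p z.2 * F z.1 z.2 := by
  simp only [expectPair, expect, Finset.mul_sum, ← mul_assoc]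
  rw [Fintype.sum_prod_type]

/-- Exchanging the coordinates in `I` between the two points is an involution that preserves the
product measure. -/
theorem expectPair_mix (I : Finset (Fin n)) (F : Cube n → Cube n → ℝ) :
    expectPair p (fun x y => F (mix I x y) (mix I y x)) = expectPair p F := by
  let e : Cube n × Cube n ≃ Cube n × Cube n :=
    { toFun := fun z => (mix I z.1 z.2, mix I z.2 z.1)
      invFun := fun z => (mix I z.1 z.2, mix I z.2 z.1)
      left_inv := fun z => by simp [mix_mix]
      right_inv := fun z => by simp [mix_mix] }
  rw [expectPair_eq_sum, expectPair_eq_sum]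
  refine Fintype.sum_equiv e _ _ fun z => ?_
  simp [e, muP_mix_mul]

theorem expectPair_fst (F : Cube n → ℝ) : expectPair p (fun x _ => F x) = expect p F := by
  simp [expectPair, expect_const]

theorem expectPair_mono (h0 : 0 < p) (h1 : p < 1) {F G : Cube n → Cube n → ℝ}
    (h : ∀ x y, F x y ≤ G x y) : expectPair p F ≤ expectPair p G :=
  expect_mono h0 h1 fun x => expect_mono h0 h1 fun y => h x y

theorem expectPair_add (F G : Cube n → Cube n → ℝ) :
    expectPair p (fun x y => F x y + G x y) = expectPair p F + expectPair p G := by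
  simp only [expectPair, expect_add]

theorem expectPair_const_mul (a : ℝ) (F : Cube n → Cube n → ℝ) :
    expectPair p (fun x y => a * F x y) = a * expectPair p F := by
  simp only [expectPair, expect_const_mul]

/-- Conditioning on the value of one coordinate. -/
theorem expect_eq_update (i : Fin n) (F : Cube n → ℝ) :
    expect p F = p * expect p (fun x => F (Function.update x i true)) +
      (1 - p) * expect p (fun x => F (Function.update x i false)) := by
  -- Overwriting coordinate `i` of `x` by that of an independent `y` does not change the
  -- distribution; the inner average then sees only `y i`.
  rw [← expectPair_fst, ← expectPair_mix {i}]
  have hm : ∀ x y : Cube n, mix {i} x y = Function.update x i (y i) := by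
    intro x y
    funext j
    by_cases h : j = i
    · subst h; simp [mix]
    · simp [mix, h]
  simp only [hm, expectPair]
  rw [← expect_const_mul, ← expect_const_mul, ← expect_add]
  congr 1
  funext x
  exact expect_coord i fun b => F (Function.update x i b)

/-! ### Symmetrised linear forms -/

/-- The difference of the values of `∑_{i ∈ I} cᵢ xᵢ` at two points. -/
noncomputable def linDiff (c : Fin n → ℝ) (I : Finset (Fin n)) (x y : Cube n) : ℝ :=
  ∑ i ∈ I, c i * (bitVal (x i) - bitVal (y i))

/-- The expectation of a function of the symmetrised linear form. -/
noncomputable def symE (p : ℝ) (c : Fin n → ℝ) (I : Finset (Fin n)) (Φ : ℝ → ℝ) : ℝ :=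
  expectPair p fun x y => Φ (linDiff c I x y)

variable {c : Fin n → ℝ} {I : Finset (Fin n)}

theorem symE_empty (Φ : ℝ → ℝ) : symE p c ∅ Φ = Φ 0 := by
  simp [symE, linDiff, expectPair, expect_const]

theorem symE_add (Φ Ψ : ℝ → ℝ) :
    symE p c I (fun t => Φ t + Ψ t) = symE p c I Φ + symE p c I Ψ :=
  expectPair_add _ _

theorem symE_const_mul (a : ℝ) (Φ : ℝ → ℝ) :
    symE p c I (fun t => a * Φ t) = a * symE p c I Φ :=
  expectPair_const_mul _ _

theorem symE_const (a : ℝ) : symE p c I (fun _ => a) = a := by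
  simp [symE, expectPair, expect_const]

theorem symE_mono (h0 : 0 < p) (h1 : p < 1) {Φ Ψ : ℝ → ℝ} (h : ∀ t, Φ t ≤ Ψ t) :
    symE p c I Φ ≤ symE p c I Ψ :=
  expectPair_mono h0 h1 fun _ _ => h _

theorem linDiff_update_left {i : Fin n} (hi : i ∉ I) (b : Bool) (x y : Cube n) :
    linDiff c I (Function.update x i b) y = linDiff c I x y :=
  Finset.sum_congr rfl fun j hj => by
    rw [Function.update_of_ne (ne_of_mem_of_not_mem hj hi)]

theorem linDiff_update_right {i : Fin n} (hi : i ∉ I) (b : Bool) (x y : Cube n) :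
    linDiff c I x (Function.update y i b) = linDiff c I x y :=
  Finset.sum_congr rfl fun j hj => by
    rw [Function.update_of_ne (ne_of_mem_of_not_mem hj hi)]

/-- Conditioning on the values of one coordinate at both points. -/
theorem symE_insert {i : Fin n} (hi : i ∉ I) (Φ : ℝ → ℝ) :
    symE p c (insert i I) Φ = (1 - 2 * p * (1 - p)) * symE p c I Φ +
      p * (1 - p) * (symE p c I (fun t => Φ (t + c i)) + symE p c I (fun t => Φ (t - c i))) := by
  have step : ∀ x : Cube n,
      expect p (fun y => Φ (linDiff c (insert i I) x y)) =
        p * expect p (fun y => Φ (c i * (bitVal (x i) - 1) + linDiff c I x y)) +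
        (1 - p) * expect p (fun y => Φ (c i * bitVal (x i) + linDiff c I x y)) := by
    intro x
    rw [expect_eq_update i]
    have e : ∀ b, ∀ y : Cube n, linDiff c (insert i I) x (Function.update y i b) =
        c i * (bitVal (x i) - bitVal b) + linDiff c I x y := by
      intro b y
      rw [← linDiff_update_right hi b x y]
      unfold linDiff
      rw [Finset.sum_insert hi]
      simp
    simp only [e]
    simp [bitVal]
  unfold symE expectPair
  simp only [step]
  rw [expect_eq_update i]
  simp only [linDiff_update_left hi, Function.update_self]
  simp only [expect_add, expect_const_mul]
  simp only [bitVal, if_true, sub_self, mul_zero, zero_add, mul_one, zero_sub, mul_neg,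
    Bool.false_eq_true, if_false, neg_add_eq_sub, add_comm (c i)]
  ring

end BiasedCube

namespace BiasedCube

variable {n : ℕ} {p : ℝ} {c : Fin n → ℝ} {I : Finset (Fin n)}

/-! ### The squared distance to `{-1, 0, 1}` -/

/-- The squared distance to `{-1, 0, 1}`. -/
noncomputable def sqDist (t : ℝ) : ℝ := min (t ^ 2) (min ((t - 1) ^ 2) ((t + 1) ^ 2))

theorem sqDist_nonneg (t : ℝ) : 0 ≤ sqDist t := by unfold sqDist; positivity

theorem sqDist_le_sq (t : ℝ) : sqDist t ≤ t ^ 2 := min_le_left _ _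

theorem le_sqDist {a t : ℝ} (h0 : a ≤ t ^ 2) (h1 : a ≤ (t - 1) ^ 2) (h2 : a ≤ (t + 1) ^ 2) :
    a ≤ sqDist t := le_min h0 (le_min h1 h2)

theorem sqDist_neg (t : ℝ) : sqDist (-t) = sqDist t := by
  unfold sqDist
  rw [min_comm ((t - 1) ^ 2)]
  congr 1
  · ring
  · congr 1 <;> ring

theorem sq_le_sqDist {t : ℝ} (h : |t| ≤ 1 / 2) : t ^ 2 ≤ sqDist t := by
  obtain ⟨h1, h2⟩ := abs_le.1 h
  refine le_sqDist le_rfl ?_ ?_ <;> nlinarith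

theorem sub_one_sq_le_sqDist {t : ℝ} (h : 1 / 2 ≤ t) : (t - 1) ^ 2 ≤ sqDist t := by
  refine le_sqDist ?_ le_rfl ?_ <;> nlinarith

theorem quarter_le_sqDist {t : ℝ} (h : 3 / 2 ≤ |t|) : 1 / 4 ≤ sqDist t := by
  rcases le_abs.1 h with h | h <;> refine le_sqDist ?_ ?_ ?_ <;> nlinarith

/-- The ratio of `|t|` to its distance from 1 is at most 3 below `3/4` and at most 5 above `5/4`;
hence 25. -/
theorem sqDist_of_not_near {t : ℝ} (h : 1 / 2 ≤ |t|) (h' : ¬ (3 / 4 ≤ |t| ∧ |t| ≤ 5 / 4)) :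
    1 / 16 ≤ sqDist t ∧ t ^ 2 ≤ 25 * sqDist t := by
  have main : ∀ t : ℝ, 1 / 2 ≤ t → ¬ (3 / 4 ≤ t ∧ t ≤ 5 / 4) →
      1 / 16 ≤ sqDist t ∧ t ^ 2 ≤ 25 * sqDist t := by
    intro t h h'
    have := sub_one_sq_le_sqDist h
    by_cases h3 : 3 / 4 ≤ t
    · have h5 : 5 / 4 < t := by
        by_contra h5
        exact h' ⟨h3, not_lt.1 h5⟩
      constructor <;> nlinarith
    · constructor <;> nlinarith
  rcases le_total 0 t with ht | ht
  · rw [abs_of_nonneg ht] at h h'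
    exact main t h h'
  · rw [abs_of_nonpos ht] at h h'
    have := main (-t) h h'
    rwa [sqDist_neg, neg_sq] at this

/-- The left side is of order `t²` near 0 and negative near `±1`, because `3/4 < 1`. This turns a
bound on `sqDist` into one on moments. -/
theorem sq_sub_fourth_le (t : ℝ) : 3 / 4 * t ^ 2 - t ^ 4 ≤ 16 * sqDist t := by
  have main : ∀ t : ℝ, 0 ≤ t → 3 / 4 * t ^ 2 - t ^ 4 ≤ 16 * sqDist t := by
    intro t ht
    rcases le_total t (1 / 2) with h | h
    · have := sq_le_sqDist (t := t) (by rw [abs_of_nonneg ht]; exact h)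
      nlinarith [sq_nonneg t, sq_nonneg (t ^ 2)]
    · have := sub_one_sq_le_sqDist h
      nlinarith [sq_nonneg (t ^ 2 - 3 / 8), sq_nonneg (t ^ 2 - 3 / 4), sq_nonneg (t - 7 / 8),
        sq_nonneg (t - 1), sq_nonneg (t ^ 2 - 1), mul_nonneg ht (sq_nonneg (t - 1))]
  rcases le_total 0 t with ht | ht
  · exact main t ht
  · have := main (-t) (by linarith)
    rwa [sqDist_neg, neg_sq, Even.neg_pow (by decide)] at this

/-- The difference of two bits lies in `{-1, 0, 1}`, so its distance to `u - v` bounds the distance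
of `u - v` to that set. -/
theorem sqDist_sub_le {a b : Bool} (u v : ℝ) :
    sqDist (u - v) ≤ 2 * (bitVal a - u) ^ 2 + 2 * (bitVal b - v) ^ 2 := by
  have key : (u - v - (bitVal a - bitVal b)) ^ 2 ≤
      2 * (bitVal a - u) ^ 2 + 2 * (bitVal b - v) ^ 2 := by
    nlinarith [sq_nonneg ((bitVal a - u) + (bitVal b - v))]
  refine le_trans ?_ key
  unfold sqDist
  cases a <;> cases b <;> simp [bitVal]

/-! ### Bounds for symmetrised forms -/

/-- If a Boolean function is close to an affine function, then every partial symmetrised form is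
close to `{-1, 0, 1}`. -/
theorem symE_sqDist_le (h0 : 0 < p) (h1 : p < 1) {ε c₀ : ℝ} (f : Cube n → Bool)
    (hf : expect p (fun x => (bitVal (f x) - (c₀ + ∑ i, c i * bitVal (x i))) ^ 2) ≤ ε)
    (I : Finset (Fin n)) : symE p c I sqDist ≤ 4 * ε := by
  set l : Cube n → ℝ := fun x => c₀ + ∑ i, c i * bitVal (x i) with hl
  set E : Cube n → ℝ := fun x => (bitVal (f x) - l x) ^ 2 with hE
  have hD : ∀ x y, linDiff c I x y = l x - l (mix I x y) := by
    intro x y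
    simp only [hl, linDiff, add_sub_add_left_eq_sub, ← Finset.sum_sub_distrib]
    rw [← Finset.sum_subset (Finset.subset_univ I)]
    · refine Finset.sum_congr rfl fun i hi => ?_
      simp [mix, hi, mul_sub]
    · intro i _ hi
      simp [mix, hi]
  calc symE p c I sqDist
      ≤ expectPair p (fun x y => 2 * E x + 2 * E (mix I x y)) :=
        expectPair_mono h0 h1 fun x y => by rw [hD]; exact sqDist_sub_le _ _
    _ = 2 * expectPair p (fun x _ => E x) + 2 * expectPair p (fun x y => E (mix I x y)) := by
        rw [expectPair_add, expectPair_const_mul, expectPair_const_mul]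
    _ = 4 * expect p E := by
        rw [expectPair_mix I (fun x _ => E x), expectPair_fst]; ring
    _ ≤ 4 * ε := by linarith

theorem symE_sq (I : Finset (Fin n)) :
    symE p c I (fun t => t ^ 2) = 2 * p * (1 - p) * ∑ i ∈ I, c i ^ 2 := by
  induction I using Finset.induction_on with
  | empty => simp [symE_empty]
  | insert i I hi ih =>
    rw [symE_insert hi, ← symE_add]
    have : (fun t : ℝ => (t + c i) ^ 2 + (t - c i) ^ 2) = fun t => 2 * t ^ 2 + 2 * c i ^ 2 := by
      funext t; ring
    rw [this, symE_add, symE_const_mul, symE_const, ih, Finset.sum_insert hi]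
    ring

theorem two_mul_mul_bounds (h0 : 0 < p) (h1 : p < 1) :
    0 < 2 * p * (1 - p) ∧ 2 * p * (1 - p) ≤ 1 / 2 := by
  constructor
  · have : 0 < 1 - p := by linarith
    positivity
  · nlinarith [sq_nonneg (p - 1 / 2)]

/-- A new coordinate adds `6vqc² + qc⁴` to the fourth moment: the square on the right absorbs the
first term, and `c² ≤ 1/4` the second. -/
theorem symE_fourth_le (h0 : 0 < p) (h1 : p < 1) (hc : ∀ i ∈ I, |c i| ≤ 1 / 2) :
    symE p c I (fun t => t ^ 4) ≤
      3 * symE p c I (fun t => t ^ 2) ^ 2 + symE p c I (fun t => t ^ 2) / 4 := by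
  induction I using Finset.induction_on with
  | empty => simp [symE_empty]
  | insert i I hi ih =>
    have ih := ih fun j hj => hc j (Finset.mem_insert_of_mem hj)
    have e4 : (fun t : ℝ => (t + c i) ^ 4 + (t - c i) ^ 4) =
        fun t => (2 * t ^ 4 + (12 * c i ^ 2) * t ^ 2) + 2 * c i ^ 4 := by
      funext t; ring
    have e2 : symE p c (insert i I) (fun t => t ^ 2) =
        symE p c I (fun t => t ^ 2) + 2 * p * (1 - p) * c i ^ 2 := by
      rw [symE_sq, symE_sq, Finset.sum_insert hi]; ring
    rw [e2, symE_insert hi, ← symE_add, e4, symE_add, symE_add, symE_const_mul, symE_const_mul,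
      symE_const]
    set v := symE p c I (fun t => t ^ 2)
    set m := symE p c I (fun t => t ^ 4)
    have hq := (two_mul_mul_bounds h0 h1).1
    set q := 2 * p * (1 - p) with hq'
    have hpq : p * (1 - p) = q / 2 := by rw [hq']; ring
    rw [hpq]
    have hci : c i ^ 2 ≤ 1 / 4 := by
      have := hc i (Finset.mem_insert_self i I)
      rw [← sq_abs]
      nlinarith [abs_nonneg (c i)]
    have h4 : q * c i ^ 4 ≤ q * c i ^ 2 / 4 := by
      have : c i ^ 4 ≤ c i ^ 2 / 4 := by nlinarith [sq_nonneg (c i)]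
      nlinarith
    nlinarith [sq_nonneg (q * c i ^ 2)]

/-- The part of the form with small coefficients has small second moment. -/
theorem symE_sq_le_of_small (h0 : 0 < p) (h1 : p < 1) {ε : ℝ} (hε : ε ≤ 1 / 100000)
    (hI : ∀ J, symE p c J sqDist ≤ 4 * ε) (hc : ∀ i ∈ I, |c i| ≤ 1 / 2) :
    symE p c I (fun t => t ^ 2) ≤ 256 * ε := by
  have hε0 : 0 ≤ ε := by
    have := hI ∅
    rw [symE_empty] at this
    have := sqDist_nonneg 0
    linarith
  induction I using Finset.induction_on with
  | empty => simp [symE_empty, hε0]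
  | insert i I hi ih =>
    have ih := ih fun j hj => hc j (Finset.mem_insert_of_mem hj)
    have h4 := symE_fourth_le h0 h1 hc
    have e2 : symE p c (insert i I) (fun t => t ^ 2) =
        symE p c I (fun t => t ^ 2) + 2 * p * (1 - p) * c i ^ 2 := by
      rw [symE_sq, symE_sq, Finset.sum_insert hi]; ring
    have hone : 2 * p * (1 - p) * c i ^ 2 ≤ 4 * ε := by
      have h := hI (insert i ∅)
      rw [symE_insert (by simp), symE_empty, symE_empty, symE_empty, zero_add, zero_sub,
        sqDist_neg] at h
      have hsq := sq_le_sqDist (hc i (Finset.mem_insert_self i I))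
      have hz : sqDist 0 = 0 := le_antisymm (by simpa using sqDist_le_sq 0) (sqDist_nonneg 0)
      rw [hz] at h
      have hq := (two_mul_mul_bounds h0 h1).1
      nlinarith
    have hlow : 3 / 4 * symE p c (insert i I) (fun t => t ^ 2) -
        symE p c (insert i I) (fun t => t ^ 4) ≤ 64 * ε := by
      have hm := symE_mono (c := c) (I := insert i I) h0 h1
        (Φ := fun t => 3 / 4 * t ^ 2 + (-1) * t ^ 4) (Ψ := fun t => 16 * sqDist t)
        (fun t => by have := sq_sub_fourth_le t; linarith)
      rw [symE_add, symE_const_mul, symE_const_mul, symE_const_mul] at hm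
      have := hI (insert i I)
      linarith
    have hv0 : 0 ≤ symE p c (insert i I) (fun t => t ^ 2) := by
      have := symE_mono (c := c) (I := insert i I) h0 h1 (Φ := fun _ => 0) (Ψ := fun t => t ^ 2)
        (fun t => sq_nonneg t)
      rwa [symE_const] at this
    set v := symE p c (insert i I) (fun t => t ^ 2)
    -- The moment inequality `v/2 - 3v² ≤ 64ε` alone would also allow large `v`; the bound from the
    -- previous set plus one coordinate excludes that branch.
    have hv : v ≤ 260 * ε := by linarith
    nlinarith

/-- The contribution of the event that no coordinate differs. -/
theorem pow_mul_le_symE (h0 : 0 < p) (h1 : p < 1) (I : Finset (Fin n)) {Φ : ℝ → ℝ}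
    (hΦ : ∀ t, 0 ≤ Φ t) : (1 - 2 * p * (1 - p)) ^ I.card * Φ 0 ≤ symE p c I Φ := by
  have hq := two_mul_mul_bounds h0 h1
  induction I using Finset.induction_on with
  | empty => simp [symE_empty]
  | insert i I hi ih =>
    rw [symE_insert hi, Finset.card_insert_of_notMem hi, pow_succ]
    have hn : ∀ a : ℝ, 0 ≤ symE p c I (fun t => Φ (t + a)) := fun a => by
      have := symE_mono (c := c) (I := I) h0 h1 (Φ := fun _ => 0) (Ψ := fun t => Φ (t + a))
        (fun t => hΦ _)
      rwa [symE_const] at this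
    have ha := hn (c i)
    have hb := hn (-c i)
    simp only [← sub_eq_add_neg] at hb
    have hpp : 0 ≤ p * (1 - p) := by linarith
    have := mul_le_mul_of_nonneg_left ih (by linarith : 0 ≤ 1 - 2 * p * (1 - p))
    nlinarith [mul_nonneg hpp (add_nonneg ha hb)]

/-- The contribution of the event that exactly one coordinate differs. -/
theorem pow_mul_sum_le_symE (h0 : 0 < p) (h1 : p < 1) (I : Finset (Fin n)) {Φ : ℝ → ℝ}
    (hΦ : ∀ t, 0 ≤ Φ t) :
    (1 - 2 * p * (1 - p)) ^ I.card * (p * (1 - p)) * ∑ i ∈ I, (Φ (c i) + Φ (-c i)) ≤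
      symE p c I Φ := by
  have hq := two_mul_mul_bounds h0 h1
  induction I using Finset.induction_on with
  | empty => simpa [symE_empty] using hΦ 0
  | insert i I hi ih =>
    rw [symE_insert hi, Finset.card_insert_of_notMem hi, Finset.sum_insert hi]
    have ha := pow_mul_le_symE (c := c) h0 h1 I (Φ := fun t => Φ (t + c i)) (fun t => hΦ _)
    have hb := pow_mul_le_symE (c := c) h0 h1 I (Φ := fun t => Φ (t - c i)) (fun t => hΦ _)
    simp only [zero_add, zero_sub] at ha hb
    have hpp : 0 ≤ p * (1 - p) := by linarith
    have hr0 : 0 ≤ 1 - 2 * p * (1 - p) := by linarith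
    have hr1 : 1 - 2 * p * (1 - p) ≤ 1 := by linarith
    set r := 1 - 2 * p * (1 - p)
    have hstep := mul_le_mul_of_nonneg_left ih hr0
    have hsum := mul_le_mul_of_nonneg_left (add_le_add ha hb) hpp
    have hpow : r ^ (I.card + 1) * (p * (1 - p) * (Φ (c i) + Φ (-c i))) ≤
        r ^ I.card * (p * (1 - p) * (Φ (c i) + Φ (-c i))) :=
      mul_le_mul_of_nonneg_right (pow_le_pow_of_le_one hr0 hr1 (Nat.le_succ _))
        (mul_nonneg hpp (add_nonneg (hΦ _) (hΦ _)))
    rw [pow_succ] at hpow ⊢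
    nlinarith

/-- The contribution of the event that exactly two coordinates differ. -/
theorem pow_mul_card_le_symE_sqDist (h0 : 0 < p) (h1 : p < 1)
    (hc : ∀ i ∈ I, 3 / 4 ≤ |c i|) :
    (1 - 2 * p * (1 - p)) ^ I.card * (2 * p * (1 - p)) ^ 2 / 16 * (I.card * (I.card - 1)) ≤
      symE p c I sqDist := by
  have hq := two_mul_mul_bounds h0 h1
  induction I using Finset.induction_on with
  | empty => simpa [symE_empty] using sqDist_nonneg 0
  | insert i I hi ih =>
    have ih := ih fun j hj => hc j (Finset.mem_insert_of_mem hj)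
    rw [symE_insert hi, Finset.card_insert_of_notMem hi, ← symE_add]
    -- This `Φ` collects the two signs of a change at `i`, so a single change within `I` produces
    -- the pairs containing `i`.
    have hone := pow_mul_sum_le_symE (c := c) h0 h1 I
      (Φ := fun t => sqDist (t + c i) + sqDist (t - c i))
      (fun t => add_nonneg (sqDist_nonneg _) (sqDist_nonneg _))
    have hterm : ∀ j ∈ I, (1 : ℝ) / 2 ≤ sqDist (c j + c i) + sqDist (c j - c i) +
        (sqDist (-c j + c i) + sqDist (-c j - c i)) := by
      intro j hj
      have e1 : sqDist (-c j + c i) = sqDist (c j - c i) := by rw [← sqDist_neg]; congr 1; ring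
      have e2 : sqDist (-c j - c i) = sqDist (c j + c i) := by rw [← sqDist_neg]; congr 1; ring
      rw [e1, e2]
      have hi3 := hc i (Finset.mem_insert_self i I)
      have hj3 := hc j (Finset.mem_insert_of_mem hj)
      have n1 := sqDist_nonneg (c j + c i)
      have n2 := sqDist_nonneg (c j - c i)
      have : 3 / 2 ≤ |c j + c i| ∨ 3 / 2 ≤ |c j - c i| := by
        rcases le_abs.1 hi3 with hi3 | hi3 <;> rcases le_abs.1 hj3 with hj3 | hj3
        · exact Or.inl (le_abs.2 (Or.inl (by linarith)))
        · exact Or.inr (le_abs.2 (Or.inr (by linarith)))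
        · exact Or.inr (le_abs.2 (Or.inl (by linarith)))
        · exact Or.inl (le_abs.2 (Or.inr (by linarith)))
      rcases this with h | h <;> have := quarter_le_sqDist h <;> linarith
    have hcard : (I.card : ℝ) * (1 / 2) ≤ ∑ j ∈ I, (sqDist (c j + c i) + sqDist (c j - c i) +
        (sqDist (-c j + c i) + sqDist (-c j - c i))) := by
      have := Finset.card_nsmul_le_sum I _ _ hterm
      simpa [nsmul_eq_mul] using this
    have hpp : 0 ≤ p * (1 - p) := by linarith
    have hr0 : 0 ≤ 1 - 2 * p * (1 - p) := by linarith
    have hr1 : 1 - 2 * p * (1 - p) ≤ 1 := by linarith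
    have h2p : 2 * p * (1 - p) = 2 * (p * (1 - p)) := by ring
    rw [h2p] at ih hone hr0 hr1 ⊢
    set w := p * (1 - p)
    set r := 1 - 2 * w
    have hrp : 0 ≤ r ^ I.card := pow_nonneg hr0 _
    have hstep := mul_le_mul_of_nonneg_left ih hr0
    have hone' := (mul_le_mul_of_nonneg_left hcard (mul_nonneg hrp hpp)).trans hone
    have hone'' := mul_le_mul_of_nonneg_left hone' hpp
    have hpow : r ^ I.card * r * (w ^ 2 * I.card) ≤ r ^ I.card * (w ^ 2 * I.card) := by
      refine mul_le_mul_of_nonneg_right (mul_le_of_le_one_right hrp hr1) (by positivity)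
    rw [pow_succ]
    push_cast
    nlinarith

end BiasedCube

namespace BiasedCube

variable {n : ℕ} {p : ℝ} {c : Fin n → ℝ} {I : Finset (Fin n)}

/-! ### The structure of the linear form -/

/-- For `q ≤ 1/2` one has `(1 - q)(1 + 2q) ≥ 1`, so `1 - q ≥ exp(-2q)`, and the power is at least
`exp(-2) ≥ 1/9`. -/
theorem ninth_le_one_sub_pow {q : ℝ} (h0 : 0 < q) (h1 : q ≤ 1 / 2) {k : ℕ} (hk : k * q ≤ 1) :
    1 / 9 ≤ (1 - q) ^ k := by
  have hexp : Real.exp (-(2 * q)) ≤ 1 - q := by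
    rw [Real.exp_neg]
    have h2 : 1 + 2 * q ≤ Real.exp (2 * q) := by
      have := Real.add_one_le_exp (2 * q)
      linarith
    rw [inv_le_comm₀ (Real.exp_pos _) (by linarith)]
    refine le_trans ?_ h2
    rw [inv_le_iff_one_le_mul₀ (by linarith)]
    nlinarith
  calc (1 : ℝ) / 9 ≤ Real.exp (-2) := by
        rw [Real.exp_neg, one_div]
        have h3 : Real.exp 2 = Real.exp 1 * Real.exp 1 := by rw [← Real.exp_add]; norm_num
        have h4 := Real.exp_one_lt_d9
        have h5 := Real.exp_pos 1
        exact inv_anti₀ (Real.exp_pos _) (by rw [h3]; nlinarith)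
    _ ≤ Real.exp (k * (-(2 * q))) := Real.exp_le_exp.2 (by linarith)
    _ = Real.exp (-(2 * q)) ^ k := Real.exp_nat_mul _ _
    _ ≤ (1 - q) ^ k := pow_le_pow_left₀ (Real.exp_pos _).le hexp k

theorem sum_sqDist_le (h0 : 0 < p) (h1 : p < 1) {ε : ℝ} (hI : symE p c I sqDist ≤ 4 * ε)
    (hcard : I.card * (2 * p * (1 - p)) ≤ 1) :
    2 * p * (1 - p) * ∑ i ∈ I, sqDist (c i) ≤ 36 * ε := by
  have hq := two_mul_mul_bounds h0 h1
  have h9 := ninth_le_one_sub_pow hq.1 hq.2 hcard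
  have h := (pow_mul_sum_le_symE (c := c) h0 h1 I sqDist_nonneg).trans hI
  simp only [sqDist_neg, ← two_mul, ← Finset.mul_sum] at h
  have hs : 0 ≤ 2 * p * (1 - p) * ∑ i ∈ I, sqDist (c i) :=
    mul_nonneg hq.1.le (Finset.sum_nonneg fun i _ => sqDist_nonneg _)
  have := mul_le_mul_of_nonneg_right h9 hs
  nlinarith

theorem card_mul_card_sub_one_le (h0 : 0 < p) (h1 : p < 1) {ε : ℝ}
    (hI : symE p c I sqDist ≤ 4 * ε) (hc : ∀ i ∈ I, 3 / 4 ≤ |c i|)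
    (hcard : I.card * (2 * p * (1 - p)) ≤ 1) :
    (I.card * (I.card - 1) : ℝ) * (2 * p * (1 - p)) ^ 2 ≤ 576 * ε := by
  have hq := two_mul_mul_bounds h0 h1
  have h9 := ninth_le_one_sub_pow hq.1 hq.2 hcard
  have h := (pow_mul_card_le_symE_sqDist h0 h1 hc).trans hI
  have hn : (0 : ℝ) ≤ I.card * (I.card - 1) := by
    rcases Nat.eq_zero_or_pos I.card with h | h
    · simp [h]
    · have : (1 : ℝ) ≤ I.card := by exact_mod_cast h
      nlinarith
  have := mul_le_mul_of_nonneg_right h9 (mul_nonneg hn (sq_nonneg (2 * p * (1 - p))))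
  nlinarith

/-- A set of size more than `1/q` has a subset of size about `1/q`. -/
theorem exists_subset_card_mul {q : ℝ} (h0 : 0 < q) (h1 : q ≤ 1 / 2) (hI : 1 < I.card * q) :
    ∃ J ⊆ I, J.card * q ≤ 1 ∧ 1 / 2 ≤ J.card * q ∧ 2 ≤ J.card := by
  have hfl : (⌊1 / q⌋₊ : ℝ) ≤ 1 / q := Nat.floor_le (by positivity)
  have hlt := Nat.lt_floor_add_one (1 / q)
  have hle : (⌊1 / q⌋₊ : ℝ) * q ≤ 1 := by rwa [le_div_iff₀ h0] at hfl
  have hge : 1 / 2 ≤ (⌊1 / q⌋₊ : ℝ) * q := by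
    rw [div_lt_iff₀ h0] at hlt
    linarith
  have hcard : ⌊1 / q⌋₊ ≤ I.card := by
    have : (⌊1 / q⌋₊ : ℝ) ≤ I.card := by
      refine hfl.trans ?_
      rw [div_le_iff₀ h0]
      exact hI.le
    exact_mod_cast this
  obtain ⟨J, hJ, hJc⟩ := Finset.exists_subset_card_eq hcard
  refine ⟨J, hJ, ?_⟩
  rw [hJc]
  refine ⟨hle, hge, Nat.le_floor ?_⟩
  rw [le_div_iff₀ h0]
  push_cast
  linarith

/-- Otherwise a subset of size between `1/(2q)` and `1/q` would make the sum in `sum_sqDist_le` at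
least `1/32`. -/
theorem card_mul_le_one_of_not_near (h0 : 0 < p) (h1 : p < 1) {ε : ℝ} (hε : ε ≤ 1 / 100000)
    (hI : ∀ J, symE p c J sqDist ≤ 4 * ε) (hc : ∀ i ∈ I, 1 / 16 ≤ sqDist (c i)) :
    I.card * (2 * p * (1 - p)) ≤ 1 := by
  have hq := two_mul_mul_bounds h0 h1
  by_contra! h
  obtain ⟨J, hJI, hJ1, hJ2, -⟩ := exists_subset_card_mul hq.1 hq.2 h
  have hs := sum_sqDist_le h0 h1 (hI J) hJ1
  have hcs : (J.card : ℝ) * (1 / 16) ≤ ∑ i ∈ J, sqDist (c i) := by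
    have := Finset.card_nsmul_le_sum J _ _ fun i hi => hc i (hJI hi)
    simpa [nsmul_eq_mul] using this
  have := mul_le_mul_of_nonneg_left hcs hq.1.le
  linarith

/-- Here single changes may cost nothing, so pairs are counted instead; the subset has at least two
elements, whence `|J| - 1 ≥ |J|/2`. -/
theorem card_mul_le_one_of_near (h0 : 0 < p) (h1 : p < 1) {ε : ℝ} (hε : ε ≤ 1 / 100000)
    (hI : ∀ J, symE p c J sqDist ≤ 4 * ε) (hc : ∀ i ∈ I, 3 / 4 ≤ |c i|) :
    I.card * (2 * p * (1 - p)) ≤ 1 := by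
  have hq := two_mul_mul_bounds h0 h1
  by_contra! h
  obtain ⟨J, hJI, hJ1, hJ2, hJ3⟩ := exists_subset_card_mul hq.1 hq.2 h
  have hs := card_mul_card_sub_one_le h0 h1 (hI J) (fun i hi => hc i (hJI hi)) hJ1
  have hJ3' : (2 : ℝ) ≤ J.card := by exact_mod_cast hJ3
  set q := 2 * p * (1 - p)
  have h2 : (1 / 2) * (1 / 2) ≤ (J.card * q) * (J.card * q) := by
    refine mul_le_mul hJ2 hJ2 (by norm_num) (by linarith)
  have h3 : (J.card * J.card / 2 : ℝ) * q ^ 2 ≤ (J.card * (J.card - 1) : ℝ) * q ^ 2 :=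
    mul_le_mul_of_nonneg_right (by nlinarith) (sq_nonneg q)
  nlinarith

/-- A Boolean function close to an affine function is close to a constant plus a signed sum of
few coordinates. -/
theorem exists_close_signed_sum (h0 : 0 < p) (h1 : p < 1) {ε c₀ : ℝ} (hε : ε ≤ 1 / 100000)
    (f : Cube n → Bool)
    (hf : expect p (fun x => (bitVal (f x) - (c₀ + ∑ i, c i * bitVal (x i))) ^ 2) ≤ ε) :
    ∃ (a : ℝ) (G : Finset (Fin n)) (s : Fin n → ℝ), (∀ i, s i = 1 ∨ s i = -1) ∧
      (G.card * (G.card - 1) : ℝ) * (2 * p * (1 - p)) ^ 2 ≤ 576 * ε ∧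
      expect p (fun x => (bitVal (f x) - (a + ∑ i ∈ G, s i * bitVal (x i))) ^ 2) ≤ 2602 * ε := by
  classical
  have hI := symE_sqDist_le h0 h1 f hf
  have hq := two_mul_mul_bounds h0 h1
  set A : Finset (Fin n) := Finset.univ.filter fun i => |c i| ≤ 1 / 2 with hA
  set B : Finset (Fin n) := Finset.univ.filter fun i => ¬ |c i| ≤ 1 / 2 with hB
  set G : Finset (Fin n) := B.filter fun i => 3 / 4 ≤ |c i| ∧ |c i| ≤ 5 / 4 with hG
  set M : Finset (Fin n) := B.filter fun i => ¬ (3 / 4 ≤ |c i| ∧ |c i| ≤ 5 / 4) with hM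
  set s : Fin n → ℝ := fun i => if 0 ≤ c i then 1 else -1 with hs
  set r : Fin n → ℝ := fun i => if i ∈ G then c i - s i else c i with hr
  have hG3 : ∀ i ∈ G, 3 / 4 ≤ |c i| := fun i hi => (Finset.mem_filter.1 hi).2.1
  have hGcard := card_mul_le_one_of_near h0 h1 hε hI hG3
  have hMnear : ∀ i ∈ M, 1 / 16 ≤ sqDist (c i) ∧ c i ^ 2 ≤ 25 * sqDist (c i) := fun i hi => by
    obtain ⟨hiB, hi2⟩ := Finset.mem_filter.1 hi
    exact sqDist_of_not_near (not_le.1 (Finset.mem_filter.1 hiB).2).le hi2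
  have hMcard := card_mul_le_one_of_not_near h0 h1 hε hI fun i hi => (hMnear i hi).1
  have hsumA : 2 * p * (1 - p) * ∑ i ∈ A, r i ^ 2 ≤ 256 * ε := by
    have h := symE_sq_le_of_small (I := A) h0 h1 hε hI fun i hi => (Finset.mem_filter.1 hi).2
    rw [symE_sq] at h
    refine le_of_eq_of_le ?_ h
    congr 1
    refine Finset.sum_congr rfl fun i hi => ?_
    have : i ∉ G := fun hiG => by
      have h3 := hG3 i hiG
      have h4 := (Finset.mem_filter.1 hi).2
      linarith
    simp [hr, this]
  have hsumM : 2 * p * (1 - p) * ∑ i ∈ M, r i ^ 2 ≤ 900 * ε := by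
    have h := sum_sqDist_le h0 h1 (hI M) hMcard
    have h2 : ∑ i ∈ M, r i ^ 2 ≤ 25 * ∑ i ∈ M, sqDist (c i) := by
      rw [Finset.mul_sum]
      refine Finset.sum_le_sum fun i hi => ?_
      have : i ∉ G := fun hiG => (Finset.mem_filter.1 hi).2 (Finset.mem_filter.1 hiG).2
      simpa [hr, this] using (hMnear i hi).2
    have := mul_le_mul_of_nonneg_left h2 hq.1.le
    linarith
  have hsumG : 2 * p * (1 - p) * ∑ i ∈ G, r i ^ 2 ≤ 36 * ε := by
    have h := sum_sqDist_le h0 h1 (hI G) hGcard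
    refine le_trans (mul_le_mul_of_nonneg_left (Finset.sum_le_sum fun i hi => ?_) hq.1.le) h
    have h3 := hG3 i hi
    simp only [hr, hi, if_true, hs]
    split_ifs with hc
    · rw [abs_of_nonneg hc] at h3
      exact sub_one_sq_le_sqDist (by linarith)
    · rw [abs_of_neg (not_le.1 hc)] at h3
      have := sub_one_sq_le_sqDist (t := -c i) (by linarith)
      rw [sqDist_neg] at this
      refine le_of_eq_of_le ?_ this
      ring
  have hsplit : ∀ F : Fin n → ℝ, ∑ i, F i = ∑ i ∈ A, F i + (∑ i ∈ G, F i + ∑ i ∈ M, F i) := by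
    intro F
    rw [hG, hM, Finset.sum_filter_add_sum_filter_not, hA, hB, Finset.sum_filter_add_sum_filter_not]
  have hvar : symE p r Finset.univ (fun t => t ^ 2) ≤ 1300 * ε := by
    rw [symE_sq, hsplit]
    have hε0 : 0 ≤ ε := by
      have h := hI ∅
      rw [symE_empty] at h
      have := sqDist_nonneg 0
      linarith
    linarith
  -- Fixing a good second point `y` shows that the residual form is close to the constant `∑ rᵢyᵢ`,
  -- with no need to compute its mean.
  obtain ⟨y, hy⟩ := exists_le_expect h0 h1 fun y =>
    expect p fun x => linDiff r Finset.univ y x ^ 2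
  have hy := hy.trans hvar
  refine ⟨c₀ + ∑ i, r i * bitVal (y i), G, s, fun i => ?_, ?_, ?_⟩
  · simp only [hs]
    split_ifs <;> simp
  · exact card_mul_card_sub_one_le h0 h1 (hI G) hG3 hGcard
  · have hpt : ∀ x : Cube n,
        (bitVal (f x) - (c₀ + ∑ i, r i * bitVal (y i) + ∑ i ∈ G, s i * bitVal (x i))) ^ 2 ≤
        2 * (bitVal (f x) - (c₀ + ∑ i, c i * bitVal (x i))) ^ 2 +
        2 * linDiff r Finset.univ y x ^ 2 := by
      intro x
      have e1 : ∑ i ∈ G, s i * bitVal (x i) =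
          ∑ i, c i * bitVal (x i) - ∑ i, r i * bitVal (x i) := by
        rw [← Finset.sum_sub_distrib, ← Finset.sum_subset (Finset.subset_univ G)]
        · refine Finset.sum_congr rfl fun i hi => ?_
          simp only [hr, hi, if_true]
          ring
        · intro i _ hi
          simp [hr, hi]
      have e2 : linDiff r Finset.univ y x =
          ∑ i, r i * bitVal (y i) - ∑ i, r i * bitVal (x i) := by
        simp [linDiff, mul_sub, Finset.sum_sub_distrib]
      rw [e1, e2]
      set u := ∑ i, c i * bitVal (x i)
      set v := ∑ i, r i * bitVal (x i)
      set w := ∑ i, r i * bitVal (y i)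
      nlinarith [sq_nonneg ((bitVal (f x) - (c₀ + u)) - (v - w))]
    have h := expect_mono h0 h1 hpt
    rw [expect_add, expect_const_mul, expect_const_mul] at h
    linarith

end BiasedCube

namespace BiasedCube

variable {n : ℕ} {p : ℝ}

/-! ### From signed sums to maxima -/

theorem bitVal_not (b : Bool) : bitVal (!b) = 1 - bitVal b := by cases b <;> simp [bitVal]

theorem maxVars_eq_ite (S : Finset (Fin n)) (x : Cube n) [Decidable (∃ i ∈ S, x i = true)] :
    maxVars S x = if ∃ i ∈ S, x i = true then 1 else 0 := by
  have h : S.sup x = true ↔ ∃ i ∈ S, x i = true := by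
    rw [← Bool.not_eq_false, show false = (⊥ : Bool) from rfl, Finset.sup_eq_bot_iff]
    simp
  simp only [maxVars, boolFun, bitVal, h]

theorem maxVars_empty (x : Cube n) : maxVars ∅ x = 0 := by
  classical
  simp [maxVars_eq_ite]

theorem maxVars_singleton (k : Fin n) (x : Cube n) : maxVars {k} x = bitVal (x k) := by
  classical
  simp [maxVars_eq_ite, bitVal]

/-- Rounding a real approximation of a bit at most doubles the distance. -/
theorem sub_sq_le_four_mul (b : Bool) {t m : ℝ} (hm : m = if 1 / 2 ≤ t then 1 else 0) :
    (bitVal b - m) ^ 2 ≤ 4 * (bitVal b - t) ^ 2 := by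
  split_ifs at hm with h <;> subst hm <;> cases b <;> simp only [bitVal] <;> norm_num <;>
    nlinarith

theorem isClose_of_forall_le (h0 : 0 < p) (h1 : p < 1) {g m e : Cube n → ℝ} {K ε δ : ℝ}
    (hK : 0 ≤ K) (he : expect p e ≤ ε) (h : ∀ x, (g x - m x) ^ 2 ≤ K * e x) (hδ : K * ε ≤ δ) :
    IsClose p δ g m := by
  have := expect_mono h0 h1 h
  rw [expect_const_mul] at this
  exact (this.trans (mul_le_mul_of_nonneg_left he hK)).trans hδ

/-- A Boolean function close to a constant is close to `0` or `1`. -/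
theorem isClose_maxVars_of_const (h0 : 0 < p) (h1 : p < 1) {a ε δ : ℝ} (f : Cube n → Bool)
    (hf : expect p (fun x => (bitVal (f x) - a) ^ 2) ≤ ε) (hδ : 4 * ε ≤ δ) :
    IsClose p δ (boolFun f) (maxVars ∅) ∨ IsClose p δ (1 - boolFun f) (maxVars ∅) := by
  by_cases ha : 1 / 2 ≤ a
  · refine Or.inr (isClose_of_forall_le h0 h1 (by norm_num) hf (fun x => ?_) hδ)
    have := sub_sq_le_four_mul (f x) (t := a) (m := 1) (by simp only [ha, if_true])
    rw [maxVars_empty, Pi.sub_apply, Pi.one_apply, boolFun]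
    nlinarith
  · refine Or.inl (isClose_of_forall_le h0 h1 (by norm_num) hf (fun x => ?_) hδ)
    have := sub_sq_le_four_mul (f x) (t := a) (m := 0) (by simp only [ha, if_false])
    rw [maxVars_empty, boolFun]
    exact this

/-- A Boolean function close to a function of one coordinate is close to a constant, that
coordinate or its negation. -/
theorem exists_isClose_maxVars_of_single (h0 : 0 < p) (h1 : p < 1) {a s ε δ : ℝ} (k : Fin n)
    (f : Cube n → Bool)
    (hf : expect p (fun x => (bitVal (f x) - (a + s * bitVal (x k))) ^ 2) ≤ ε) (hδ : 4 * ε ≤ δ) :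
    ∃ S : Finset (Fin n), S.card ≤ 1 ∧
      (IsClose p δ (boolFun f) (maxVars S) ∨ IsClose p δ (1 - boolFun f) (maxVars S)) := by
  have hpt : ∀ x, (bitVal (f x) - if x k = true then (if 1 / 2 ≤ a + s then 1 else 0) else
      (if 1 / 2 ≤ a then 1 else 0)) ^ 2 ≤ 4 * (bitVal (f x) - (a + s * bitVal (x k))) ^ 2 :=
    fun x => sub_sq_le_four_mul (f x) (by cases x k <;> simp [bitVal])
  have neg : ∀ u v : ℝ, (1 - u - v) ^ 2 = (u - (1 - v)) ^ 2 := fun u v => by ring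
  by_cases ha : 1 / 2 ≤ a <;> by_cases hb : 1 / 2 ≤ a + s
  · refine ⟨∅, by simp, Or.inr (isClose_of_forall_le h0 h1 (by norm_num) hf (fun x => ?_) hδ)⟩
    refine le_of_eq_of_le ?_ (hpt x)
    rw [maxVars_empty, Pi.sub_apply, Pi.one_apply, boolFun, neg]
    simp only [ha, hb, if_true]
    cases x k <;> simp [bitVal]
  · refine ⟨{k}, by simp, Or.inr (isClose_of_forall_le h0 h1 (by norm_num) hf (fun x => ?_) hδ)⟩
    refine le_of_eq_of_le ?_ (hpt x)
    rw [maxVars_singleton, Pi.sub_apply, Pi.one_apply, boolFun, neg]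
    simp only [ha, hb, if_true, if_false]
    cases x k <;> simp [bitVal]
  · refine ⟨{k}, by simp, Or.inl (isClose_of_forall_le h0 h1 (by norm_num) hf (fun x => ?_) hδ)⟩
    refine le_of_eq_of_le ?_ (hpt x)
    rw [maxVars_singleton, boolFun]
    simp only [ha, hb, if_true, if_false]
    cases x k <;> simp [bitVal]
  · refine ⟨∅, by simp, Or.inl (isClose_of_forall_le h0 h1 (by norm_num) hf (fun x => ?_) hδ)⟩
    refine le_of_eq_of_le ?_ (hpt x)
    rw [maxVars_empty, boolFun]
    simp only [ha, hb, if_false]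
    cases x k <;> simp [bitVal]

theorem expect_bitVal (i : Fin n) : expect p (fun x => bitVal (x i)) = p := by
  rw [expect_coord i bitVal]
  simp [bitVal]

theorem expect_bitVal_mul {i j : Fin n} (hij : i ≠ j) :
    expect p (fun x => bitVal (x i) * bitVal (x j)) = p ^ 2 := by
  rw [expect_eq_update i]
  simp only [Function.update_self, Function.update_of_ne hij.symm, expect_const_mul, expect_bitVal]
  simp [bitVal, sq]

theorem expect_sum_pairs (G : Finset (Fin n)) :
    expect p (fun x => ∑ i ∈ G, ∑ j ∈ G.erase i, bitVal (x i) * bitVal (x j)) =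
      G.card * (G.card - 1) * p ^ 2 := by
  simp only [expect_sum]
  have : ∀ i ∈ G, ∑ j ∈ G.erase i, expect p (fun x => bitVal (x i) * bitVal (x j)) =
      (G.card - 1) * p ^ 2 := by
    intro i hi
    rw [Finset.sum_congr rfl fun j hj => expect_bitVal_mul (Finset.ne_of_mem_erase hj).symm,
      Finset.sum_const, Finset.card_erase_of_mem hi, nsmul_eq_mul,
      Nat.cast_sub (Finset.card_pos.2 ⟨i, hi⟩), Nat.cast_one]
  rw [Finset.sum_congr rfl this, Finset.sum_const, nsmul_eq_mul, mul_assoc]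

theorem bitVal_nonneg (b : Bool) : 0 ≤ bitVal b := by cases b <;> simp [bitVal]

/-- With two ones in `G` the double sum is at least 1. With at most one, a bit different from the
maximum has approximation error at least `3/4`, and `2 · 9/16 ≥ 1`; a lone term of sign -1 pushes
the value towards -1, where rounding to 0 is right. -/
theorem sub_maxVars_sq_le {a : ℝ} (ha : |a| ≤ 1 / 4) (G : Finset (Fin n)) {s : Fin n → ℝ}
    (hs : ∀ i, s i = 1 ∨ s i = -1) (b : Bool) (x : Cube n) :
    (bitVal b - maxVars (G.filter fun i => s i = 1) x) ^ 2 ≤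
      ∑ i ∈ G, ∑ j ∈ G.erase i, bitVal (x i) * bitVal (x j) +
        2 * (bitVal b - (a + ∑ i ∈ G, s i * bitVal (x i))) ^ 2 := by
  classical
  obtain ⟨ha1, ha2⟩ := abs_le.1 ha
  have hpos : ∀ i j, 0 ≤ bitVal (x i) * bitVal (x j) := fun i j =>
    mul_nonneg (bitVal_nonneg _) (bitVal_nonneg _)
  have hP : 0 ≤ ∑ i ∈ G, ∑ j ∈ G.erase i, bitVal (x i) * bitVal (x j) :=
    Finset.sum_nonneg fun i _ => Finset.sum_nonneg fun j _ => hpos i j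
  set T := G.filter fun i => x i = true with hT
  have hsum : ∑ i ∈ G, s i * bitVal (x i) = ∑ i ∈ T, s i := by
    rw [hT, Finset.sum_filter]
    refine Finset.sum_congr rfl fun i _ => ?_
    cases x i <;> simp [bitVal]
  have hmax : maxVars (G.filter fun i => s i = 1) x = if ∃ i ∈ T, s i = 1 then 1 else 0 := by
    rw [maxVars_eq_ite]
    congr 1
    simp only [hT, Finset.mem_filter, eq_iff_iff]
    constructor <;> rintro ⟨i, ⟨h1, h2⟩, h3⟩ <;> exact ⟨i, ⟨h1, h3⟩, h2⟩
  rcases lt_or_ge 1 T.card with hc | hc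
  · obtain ⟨i, hi, j, hj, hij⟩ := Finset.one_lt_card.1 hc
    obtain ⟨hiG, hxi⟩ := Finset.mem_filter.1 hi
    obtain ⟨hjG, hxj⟩ := Finset.mem_filter.1 hj
    have h1 : 1 ≤ ∑ i ∈ G, ∑ j ∈ G.erase i, bitVal (x i) * bitVal (x j) := by
      refine le_trans ?_ (Finset.single_le_sum (f := fun i => ∑ j ∈ G.erase i,
        bitVal (x i) * bitVal (x j)) (fun i _ => Finset.sum_nonneg fun j _ => hpos i j) hiG)
      refine le_trans ?_ (Finset.single_le_sum (f := fun j => bitVal (x i) * bitVal (x j))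
        (fun j _ => hpos i j) (Finset.mem_erase.2 ⟨hij.symm, hjG⟩))
      simp [hxi, hxj, bitVal]
    have h2 : (bitVal b - maxVars (G.filter fun i => s i = 1) x) ^ 2 ≤ 1 := by
      rw [hmax]
      split_ifs <;> cases b <;> simp [bitVal]
    nlinarith [sq_nonneg (bitVal b - (a + ∑ i ∈ G, s i * bitVal (x i)))]
  · have key : (bitVal b - maxVars (G.filter fun i => s i = 1) x) ^ 2 ≤
        2 * (bitVal b - (a + ∑ i ∈ G, s i * bitVal (x i))) ^ 2 := by
      rw [hmax, hsum]
      rcases Nat.le_one_iff_eq_zero_or_eq_one.1 hc with h | h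
      · rw [Finset.card_eq_zero.1 h]
        cases b <;> simp [bitVal] <;> nlinarith
      · obtain ⟨k, hk⟩ := Finset.card_eq_one.1 h
        rw [hk]
        rcases hs k with hk | hk <;> cases b <;> simp [bitVal, hk] <;> norm_num <;> nlinarith
    linarith

/-- The constant term is close to `0` or `1` when the signed sum is usually zero. -/
theorem abs_le_or_of_close (h0 : 0 < p) (h1 : p < 1) {a ε : ℝ} (G : Finset (Fin n))
    {s : Fin n → ℝ} (f : Cube n → Bool) (hG : G.card * p ≤ 1 / 2) (hε : ε ≤ 1 / 32)
    (hf : expect p (fun x => (bitVal (f x) - (a + ∑ i ∈ G, s i * bitVal (x i))) ^ 2) ≤ ε) :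
    |a| ≤ 1 / 4 ∨ |1 - a| ≤ 1 / 4 := by
  have hd : 0 ≤ min (a ^ 2) ((1 - a) ^ 2) := by positivity
  -- The left side is `min (a²) ((1-a)²) · (1 - ∑ xᵢ)`: nonpositive once some coordinate of `G` is
  -- 1, while otherwise the affine value is exactly `a`.
  have hpt : ∀ x : Cube n, min (a ^ 2) ((1 - a) ^ 2) +
      (-min (a ^ 2) ((1 - a) ^ 2)) * ∑ i ∈ G, bitVal (x i) ≤
      (bitVal (f x) - (a + ∑ i ∈ G, s i * bitVal (x i))) ^ 2 := by
    intro x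
    by_cases hx : ∃ i ∈ G, x i = true
    · obtain ⟨i, hi, hxi⟩ := hx
      have : 1 ≤ ∑ i ∈ G, bitVal (x i) := by
        refine le_trans ?_ (Finset.single_le_sum (f := fun i => bitVal (x i))
          (fun i _ => bitVal_nonneg _) hi)
        simp [hxi, bitVal]
      nlinarith [sq_nonneg (bitVal (f x) - (a + ∑ i ∈ G, s i * bitVal (x i)))]
    · have hz : ∀ i ∈ G, bitVal (x i) = 0 := by
        intro i hi
        have : x i = false := by
          by_contra h
          exact hx ⟨i, hi, by simpa using h⟩
        simp [this, bitVal]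
      rw [Finset.sum_eq_zero hz, Finset.sum_eq_zero fun i hi => by rw [hz i hi, mul_zero]]
      cases f x
      · simp [bitVal]
      · simp [bitVal]
  have h := expect_mono h0 h1 hpt
  rw [expect_add, expect_const, expect_const_mul, expect_sum,
    Finset.sum_congr rfl fun i _ => expect_bitVal i, Finset.sum_const, nsmul_eq_mul] at h
  have hmin : min (a ^ 2) ((1 - a) ^ 2) ≤ (1 / 4) ^ 2 := by nlinarith
  rcases min_le_iff.1 hmin with h | h
  · exact Or.inl (abs_le_of_sq_le_sq h (by norm_num))
  · exact Or.inr (abs_le_of_sq_le_sq h (by norm_num))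

/-- The case `p ≤ 1/2`. -/
theorem exists_isClose_maxVars (h0 : 0 < p) (hp : p ≤ 1 / 2) {ε : ℝ} (f : Cube n → Bool)
    {l : Cube n → ℝ} (hl : IsAffine l) (hf : IsClose p ε (boolFun f) l) :
    ∃ S : Finset (Fin n), (S.card : ℝ) ≤ max 1 (1000000 * (√ε / p)) ∧
      (IsClose p (1000000 * ε) (boolFun f) (maxVars S) ∨
        IsClose p (1000000 * ε) (1 - boolFun f) (maxVars S)) := by
  classical
  have h1 : p < 1 := by linarith
  obtain ⟨c₀, c, hc⟩ := hl
  have hf' : expect p (fun x => (bitVal (f x) - (c₀ + ∑ i, c i * bitVal (x i))) ^ 2) ≤ ε := by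
    simpa only [IsClose, normSq_eq_expect, Pi.sub_apply, boolFun, hc] using hf
  have hε0 : 0 ≤ ε := by
    refine le_trans ?_ hf'
    have := expect_mono (n := n) h0 h1 (F := fun _ => 0)
      (G := fun x => (bitVal (f x) - (c₀ + ∑ i, c i * bitVal (x i))) ^ 2) fun x => sq_nonneg _
    rwa [expect_const] at this
  rcases lt_or_ge (1 / 100000) ε with hε | hε
  -- For such `ε` the allowed error exceeds 1, so any Boolean function will do.
  · refine ⟨∅, by simp, Or.inl (isClose_of_forall_le (K := 1) (e := fun _ => 1) h0 h1 (by norm_num)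
      (expect_const 1).le (fun x => ?_) (by linarith))⟩
    rw [maxVars_empty, boolFun]
    cases f x <;> simp [bitVal]
  obtain ⟨a, G, s, hs, hG, hfa⟩ := exists_close_signed_sum h0 h1 hε f hf'
  rcases Nat.lt_or_ge 1 G.card with hcard | hcard
  · have hcard' : (2 : ℝ) ≤ G.card := by exact_mod_cast hcard
    have hpq : p ≤ 2 * p * (1 - p) := by nlinarith
    have hpq2 : p ^ 2 ≤ (2 * p * (1 - p)) ^ 2 := pow_le_pow_left₀ h0.le hpq 2
    have hGp : (G.card * (G.card - 1) : ℝ) * p ^ 2 ≤ 576 * ε :=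
      le_trans (mul_le_mul_of_nonneg_left hpq2 (by nlinarith)) hG
    have hGp2 : (G.card * p) ^ 2 ≤ 1152 * ε := by
      have : (G.card * G.card / 2 : ℝ) * p ^ 2 ≤ (G.card * (G.card - 1) : ℝ) * p ^ 2 :=
        mul_le_mul_of_nonneg_right (by nlinarith) (sq_nonneg p)
      nlinarith
    have hhalf : G.card * p ≤ 1 / 2 := by
      refine le_of_abs_le (abs_le_of_sq_le_sq ?_ (by norm_num))
      linarith
    have hsize : (G.card : ℝ) ≤ 1000000 * (√ε / p) := by
      rw [← mul_div_assoc, le_div_iff₀ h0]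
      refine le_of_abs_le (abs_le_of_sq_le_sq ?_ (by positivity))
      rw [mul_pow, mul_pow, Real.sq_sqrt hε0]
      rw [mul_pow] at hGp2
      linarith
    have finish : ∀ (g : Cube n → Bool) (a' : ℝ) (s' : Fin n → ℝ), |a'| ≤ 1 / 4 →
        (∀ i, s' i = 1 ∨ s' i = -1) →
        expect p (fun x => (bitVal (g x) - (a' + ∑ i ∈ G, s' i * bitVal (x i))) ^ 2) ≤ 2602 * ε →
        IsClose p (1000000 * ε) (boolFun g) (maxVars (G.filter fun i => s' i = 1)) := by
      intro g a' s' ha' hs' hg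
      have h := expect_mono h0 h1 fun x => sub_maxVars_sq_le ha' G hs' (g x) x
      rw [expect_add, expect_sum_pairs, expect_const_mul] at h
      refine le_trans h ?_
      linarith
    have hsub : ∀ P : Fin n → Prop, ((G.filter P).card : ℝ) ≤ max 1 (1000000 * (√ε / p)) :=
      fun P => le_trans (by exact_mod_cast Finset.card_filter_le G P) (hsize.trans (le_max_right _ _))
    rcases abs_le_or_of_close h0 h1 G f hhalf (by linarith) hfa with ha | ha
    · exact ⟨_, hsub _, Or.inl (finish f a s ha hs hfa)⟩
    · refine ⟨G.filter fun i => -s i = 1, hsub _, Or.inr ?_⟩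
      have hneg : (1 : Cube n → ℝ) - boolFun f = boolFun fun x => !(f x) := by
        funext x
        simp only [Pi.sub_apply, Pi.one_apply, boolFun, bitVal_not]
      rw [hneg]
      refine finish _ (1 - a) (fun i => -s i) ha (fun i => ?_) (le_of_eq_of_le ?_ hfa)
      · rcases hs i with h | h <;> simp [h]
      · congr 1
        funext x
        simp only [bitVal_not, neg_mul, Finset.sum_neg_distrib]
        ring
  · have hbound : ∀ S : Finset (Fin n), S.card ≤ 1 →
        (S.card : ℝ) ≤ max 1 (1000000 * (√ε / p)) := fun S hS =>
      le_max_of_le_left (by exact_mod_cast hS)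
    rcases Nat.le_one_iff_eq_zero_or_eq_one.1 hcard with h | h
    · rw [Finset.card_eq_zero.1 h] at hfa
      simp only [Finset.sum_empty, add_zero] at hfa
      exact ⟨∅, hbound ∅ (by simp), isClose_maxVars_of_const h0 h1 f hfa (by linarith)⟩
    · obtain ⟨k, hk⟩ := Finset.card_eq_one.1 h
      rw [hk] at hfa
      simp only [Finset.sum_singleton] at hfa
      obtain ⟨S, hS, hS'⟩ := exists_isClose_maxVars_of_single (δ := 1000000 * ε) h0 h1 k f hfa
        (by linarith)
      exact ⟨S, hbound S hS, hS'⟩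

/-! ### Complementing the cube -/

/-- The pointwise complement of a point of the cube. -/
def compl (x : Cube n) : Cube n := fun i => !(x i)

theorem compl_compl (x : Cube n) : compl (compl x) = x := by
  funext i
  simp [compl]

theorem normSq_comp_compl (g : Cube n → ℝ) :
    normSq (1 - p) (fun x => g (compl x)) = normSq p g := by
  let e : Cube n ≃ Cube n := ⟨compl, compl, compl_compl, compl_compl⟩
  refine Fintype.sum_equiv e _ _ fun x => ?_
  have : muP (1 - p) x = muP p (compl x) := by
    rw [muP_eq_prod, muP_eq_prod]
    refine Finset.prod_congr rfl fun i _ => ?_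
    cases h : x i <;> simp [bitWeight, compl, h]
  rw [this]
  rfl

theorem maxVars_compl (S : Finset (Fin n)) (x : Cube n) :
    maxVars S (compl x) = 1 - minVars S x := by
  have h : S.sup (compl x) = !(S.inf x) := by
    induction S using Finset.induction_on with
    | empty => simp
    | insert i S _ ih => simp [ih, compl]
  rw [maxVars, minVars, boolFun, boolFun, h, bitVal_not]

theorem isAffine_comp_compl {l : Cube n → ℝ} (hl : IsAffine l) :
    IsAffine fun x => l (compl x) := by
  obtain ⟨c₀, c, hc⟩ := hl
  refine ⟨c₀ + ∑ i, c i, fun i => -c i, fun x => ?_⟩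
  simp only [hc]
  rw [add_assoc, ← Finset.sum_add_distrib]
  congr 1
  refine Finset.sum_congr rfl fun i _ => ?_
  rw [compl, bitVal_not]
  ring

/-- The case `1/2 ≤ p`. -/
theorem exists_isClose_minVars (h1 : p < 1) (hp : 1 / 2 ≤ p) {ε : ℝ} (f : Cube n → Bool)
    {l : Cube n → ℝ} (hl : IsAffine l) (hf : IsClose p ε (boolFun f) l) :
    ∃ S : Finset (Fin n), (S.card : ℝ) ≤ max 1 (1000000 * (√ε / (1 - p))) ∧
      (IsClose p (1000000 * ε) (boolFun f) (minVars S) ∨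
        IsClose p (1000000 * ε) (1 - boolFun f) (minVars S)) := by
  have hf' : IsClose (1 - p) ε (boolFun fun x => f (compl x)) (fun x => l (compl x)) := by
    refine le_of_eq_of_le ?_ hf
    exact normSq_comp_compl (boolFun f - l)
  obtain ⟨S, hS, h⟩ := exists_isClose_maxVars (by linarith) (by linarith) _
    (isAffine_comp_compl hl) hf'
  -- Complementation turns the maximum into 1 minus the minimum, so the cases `f` and `1 - f` trade
  -- places.
  refine ⟨S, hS, h.symm.imp (le_of_eq_of_le ?_) (le_of_eq_of_le ?_)⟩
  · rw [← normSq_comp_compl]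
    refine Finset.sum_congr rfl fun x _ => ?_
    have := maxVars_compl S (compl x)
    rw [compl_compl] at this
    simp only [Pi.sub_apply, Pi.one_apply, boolFun, this]
    ring
  · rw [← normSq_comp_compl]
    refine Finset.sum_congr rfl fun x _ => ?_
    have := maxVars_compl S (compl x)
    rw [compl_compl] at this
    simp only [Pi.sub_apply, Pi.one_apply, boolFun, this]
    ring

end BiasedCube

theorem mainTheorem2 :
    ∃ C : ℝ, 0 < C ∧
      ∀ (n : ℕ) (p ε : ℝ), 0 < p → p < 1 →
        ∀ f : BiasedCube.Cube n → Bool,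
          (∃ l : BiasedCube.Cube n → ℝ, BiasedCube.IsAffine l ∧
            BiasedCube.IsClose p ε (BiasedCube.boolFun f) l) →
          ∃ S : Finset (Fin n),
            (S.card : ℝ) ≤ max 1 (C * (Real.sqrt ε / min p (1 - p))) ∧
            (p ≤ 1 / 2 →
              BiasedCube.IsClose p (C * ε) (BiasedCube.boolFun f) (BiasedCube.maxVars S) ∨
              BiasedCube.IsClose p (C * ε) (1 - BiasedCube.boolFun f) (BiasedCube.maxVars S)) ∧
            (1 / 2 < p →
              BiasedCube.IsClose p (C * ε) (BiasedCube.boolFun f) (BiasedCube.minVars S) ∨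
              BiasedCube.IsClose p (C * ε) (1 - BiasedCube.boolFun f) (BiasedCube.minVars S)) := by
  refine ⟨1000000, by norm_num, fun n p ε h0 h1 f ⟨l, hl, hf⟩ => ?_⟩
  rcases le_or_gt p (1 / 2) with hp | hp
  · obtain ⟨S, hS, h⟩ := BiasedCube.exists_isClose_maxVars h0 hp f hl hf
    rw [min_eq_left (by linarith)]
    exact ⟨S, hS, fun _ => h, fun hp' => absurd hp (not_le.2 hp')⟩
  · obtain ⟨S, hS, h⟩ := BiasedCube.exists_isClose_minVars h1 hp.le f hl hf
    rw [min_eq_right (by linarith)]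
    exact ⟨S, hS, fun hp' => absurd hp' (not_le.2 hp), fun _ => h⟩
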